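/- Let $\mathcal A$ be a unital $C^*$-algebra, $\mathcal H$ a (left) Hilbert $\mathcal A$-module with $\mathcal A$-valued inner product $\langle\cdot,\cdot\rangle$, $\mathrm{End}^*_{\mathcal A}(\mathcal H)$ the adjointable operators on $\mathcal H$, $GL^+(\mathcal H)$ the positive bounded linear operators on $\mathcal H$ that are invertible with bounded inverse, and $(\Omega,\mu)$ a measure space. Given $K\in \mathrm{End}^*_{\mathcal A}(\mathcal H)$ and $C\in GL^+(\mathcal H)$, a map $F:\Omega\to\mathcal H$ is a *continuous $C$-controlled $K$-frame for $\mathcal H$* if $w\mapsto\langle f,F(w)\rangle$ is measurable for every $f\in\mathcal H$ and there are constants $A,B>0$ such that, for all $f\in\mathcal H$, $$A\,\langle C^{1/2}K^*f,\,C^{1/2}K^*f\rangle\;\le\;\int_\Omega\langle f,F(w)\rangle\,\langle CF(w),f\rangle\,d\mu(w)\;\le\;B\,\langle f,f\rangle ,$$ where the integral is a Bochner integral in $\mathcal A$, whose existence is part of the definition. **Theorem.** Let $C\in GL^+(\mathcal H)$, $K\in \mathrm{End}^*_{\mathcal A}(\mathcal H)$, and let $F$ be a continuous $C$-controlled $K$-frame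 for $\mathcal H$. Let $T\in \mathrm{End}^*_{\mathcal A}(\mathcal H)$ have closed range $R(T)$, and suppose that $R(K^*T^*)$ is closed and that $C$, $K$, $T$ commute pairwise. Then $TF: w\mapsto T(F(w))$ is a continuous $C$-controlled $K$-frame for the Hilbert $\mathcal A$-module $R(T)$; that is, $C$ and $K$ map $R(T)$ into itself, their restrictions satisfy $C|_{R(T)}\in GL^+(R(T))$ and $K|_{R(T)}\in \mathrm{End}^*_{\mathcal A}(R(T))$, and $TF:\Omega\to R(T)$ is a continuous $C|_{R(T)}$-controlled $K|_{R(T)}$-frame for $R(T)$ (so the adjoint of $K|_{R(T)}$ and the square root of $C|_{R(T)}$ in the frame inequality are taken in $\mathrm{End}^*_{\mathcal A}(R(T))$). -/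

import Mathlib

/-!
Hilbert `C⋆`-modules are Mathlib's `CStarModule A H` together with completeness of `H`. Mathlib's
`A`-valued inner product `inner A x y` is `A`-linear in the SECOND variable,
`inner A x (a • y) = a * inner A x y`. So the inner product `⟨x, y⟩` that is `A`-linear in the first
variable, `⟨a x, y⟩ = a ⟨x, y⟩`, is `inner A y x`.
-/

section EndStar

variable (A : Type*) [CStarAlgebra A] [PartialOrder A]
variable (H : Type*) [NormedAddCommGroup H] [NormedSpace ℂ H] [Module A H] [CStarModule A H]

/-- `S` is an adjoint of `T`: `⟨T x, y⟩ = ⟨x, S y⟩` for all `x, y`. -/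
def IsAdjointOf {H : Type*} [NormedAddCommGroup H] [NormedSpace ℂ H] [Module A H]
    [CStarModule A H] (S T : H →L[ℂ] H) : Prop :=
  ∀ x y : H, inner A y (T x) = inner A (S y) x

variable {H} in
theorem IsAdjointOf.symm {S T : H →L[ℂ] H} (h : IsAdjointOf A S T) : IsAdjointOf A T S := by
  intro x y
  rw [← CStarModule.star_inner, ← h y x, CStarModule.star_inner]

variable {H} in
theorem eq_of_inner_eq {x y : H} (h : ∀ z : H, inner A z x = inner A z y) : x = y := by
  have h1 : inner A (x - y) (x - y) = (0 : A) := by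
    rw [CStarModule.inner_sub_right, h, sub_self]
  exact sub_eq_zero.mp ((CStarModule.inner_self (A := A)).mp h1)

variable {H} in
theorem IsAdjointOf.unique {S S' T : H →L[ℂ] H} (h : IsAdjointOf A S T)
    (h' : IsAdjointOf A S' T) : S = S' := by
  ext y
  refine eq_of_inner_eq A fun z => ?_
  rw [h.symm A y z, h'.symm A y z]

/-- The adjointable operators on `H`, as a subalgebra of the bounded operators on `H`. -/
def adjointableSubalgebra : Subalgebra ℂ (H →L[ℂ] H) where
  carrier := {T | ∃ S : H →L[ℂ] H, IsAdjointOf A S T}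
  mul_mem' := by
    rintro T T' ⟨S, h⟩ ⟨S', h'⟩
    refine ⟨S' * S, fun x y => ?_⟩
    simp only [mul_apply_eq_comp]
    rw [h, h']
  add_mem' := by
    rintro T T' ⟨S, h⟩ ⟨S', h'⟩
    refine ⟨S + S', fun x y => ?_⟩
    simp only [add_apply, CStarModule.inner_add_left,
      CStarModule.inner_add_right]
    rw [h, h']
  algebraMap_mem' := by
    intro r
    refine ⟨algebraMap ℂ _ (star r), fun x y => ?_⟩
    simp [Algebra.algebraMap_eq_smul_one]

/-- `End*_A(H)`, the adjointable operators on the Hilbert `A`-module `H`. -/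
abbrev EndStar : Type _ := ↥(adjointableSubalgebra A H)

variable {H} in
/-- The adjoint `T⋆` of an adjointable operator. -/
noncomputable def EndStar.adj (T : EndStar A H) : EndStar A H :=
  ⟨T.2.choose, T.1, T.2.choose_spec.symm A⟩

variable {H} in
theorem EndStar.adj_spec (T : EndStar A H) : IsAdjointOf A (EndStar.adj A T).1 T.1 :=
  T.2.choose_spec

variable {H} in
theorem EndStar.adj_eq {S T : EndStar A H} (h : IsAdjointOf A S.1 T.1) : EndStar.adj A T = S :=
  Subtype.ext ((EndStar.adj_spec A T).unique A h)

noncomputable instance EndStar.instStarRing : StarRing (EndStar A H) where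
  star := EndStar.adj A
  star_involutive T := EndStar.adj_eq A ((EndStar.adj_spec A T).symm A)
  star_mul S T := by
    refine EndStar.adj_eq A fun x y => ?_
    simp only [MulMemClass.coe_mul, mul_apply_eq_comp]
    rw [EndStar.adj_spec A S, EndStar.adj_spec A T]
  star_add S T := by
    refine EndStar.adj_eq A fun x y => ?_
    simp only [AddMemClass.coe_add, add_apply, CStarModule.inner_add_left,
      CStarModule.inner_add_right]
    rw [EndStar.adj_spec A S, EndStar.adj_spec A T]

variable {H} in
theorem EndStar.star_spec (T : EndStar A H) : IsAdjointOf A (star T).1 T.1 :=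
  EndStar.adj_spec A T

instance EndStar.instStarModule : StarModule ℂ (EndStar A H) where
  star_smul c T := by
    refine EndStar.adj_eq A fun x y => ?_
    simp only [SetLike.val_smul, smul_apply,
      CStarModule.inner_smul_left_complex, CStarModule.inner_smul_right_complex, star_star]
    rw [EndStar.star_spec A T]

variable [StarOrderedRing A]

instance EndStar.instCStarRing : CStarRing (EndStar A H) where
  norm_mul_self_le T := by
    have key : ‖T.1‖ ≤ √‖(star T * T).1‖ := by
      refine ContinuousLinearMap.opNorm_le_bound _ (Real.sqrt_nonneg _) fun x => ?_
      have h1 : ‖T.1 x‖ ^ 2 ≤ ‖(star T * T).1‖ * ‖x‖ ^ 2 := by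
        rw [CStarModule.norm_sq_eq A, EndStar.star_spec A T x (T.1 x)]
        refine (CStarModule.norm_inner_le H).trans ?_
        have := (star T * T).1.le_opNorm x
        calc _ ≤ (‖(star T * T).1‖ * ‖x‖) * ‖x‖ := by
              gcongr
              exact this
          _ = _ := by ring
      refine le_of_sq_le_sq ?_ (by positivity)
      rw [mul_pow, Real.sq_sqrt (norm_nonneg _)]
      exact h1
    have h2 := mul_self_le_mul_self (norm_nonneg _) key
    rwa [Real.mul_self_sqrt (norm_nonneg _)] at h2

instance EndStar.instCompleteSpace [CompleteSpace H] : CompleteSpace (EndStar A H) := by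
  refine Metric.complete_of_cauchySeq_tendsto fun u hu => ?_
  have hu' : CauchySeq fun n => (u n).1 := hu.map uniformContinuous_subtype_val
  have hs' : CauchySeq fun n => (star (u n)).1 :=
    (hu.map (starₗᵢ ℂ (E := EndStar A H)).isometry.uniformContinuous).map
      uniformContinuous_subtype_val
  obtain ⟨T, hT⟩ := cauchySeq_tendsto_of_complete hu'
  obtain ⟨S, hS⟩ := cauchySeq_tendsto_of_complete hs'
  have hST : IsAdjointOf A S T := by
    intro x y
    have hTx : Filter.Tendsto (fun n => (u n).1 x) Filter.atTop (nhds (T x)) :=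
      ((ContinuousLinearMap.apply ℂ H x).continuous.tendsto T).comp hT
    have hSy : Filter.Tendsto (fun n => (star (u n)).1 y) Filter.atTop (nhds (S y)) :=
      ((ContinuousLinearMap.apply ℂ H y).continuous.tendsto S).comp hS
    have h1 := ((CStarModule.continuous_inner (A := A) (E := H)).tendsto (y, T x)).comp
      (tendsto_const_nhds.prodMk_nhds hTx)
    have h2 := ((CStarModule.continuous_inner (A := A) (E := H)).tendsto (S y, x)).comp
      (hSy.prodMk_nhds tendsto_const_nhds)
    refine tendsto_nhds_unique h1 (h2.congr fun n => ?_)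
    exact (EndStar.star_spec A (u n) x y).symm
  exact ⟨⟨T, S, hST⟩, tendsto_subtype_rng.mpr hT⟩

/-- `End*_A(H)` is a `C⋆`-algebra for the operator norm, composition and the adjoint. -/
noncomputable instance EndStar.instCStarAlgebra [CompleteSpace H] : CStarAlgebra (EndStar A H) where

end EndStar

section Frames

variable {A : Type*} [CStarAlgebra A] [PartialOrder A] [StarOrderedRing A]
variable {H : Type*} [NormedAddCommGroup H] [NormedSpace ℂ H] [Module A H] [CStarModule A H]

/-- `C ∈ GL⁺(H)`: `C` is positive, i.e. `⟨C x, x⟩ ≥ 0` for all `x`, and invertible. (A bounded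
operator with `⟨C x, x⟩ ≥ 0` for all `x` is automatically adjointable, and so is its inverse.) -/
def EndStar.IsGLPos (C : EndStar A H) : Prop :=
  (∀ x : H, 0 ≤ inner A x (C.1 x)) ∧ IsUnit C

/-- The positive square root `C^{1/2}` of a positive `C`, by functional calculus in the
`C⋆`-algebra `End*_A(H)`. -/
noncomputable def EndStar.posSqrt [CompleteSpace H] (C : EndStar A H) : EndStar A H :=
  cfc Real.sqrt C

/-- `F : Ω → H` is a continuous `C`-controlled `K`-frame for the Hilbert `A`-module `H`.
The integral is the Bochner integral in `A`; its existence is part of the definition. -/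
structure IsContinuousControlledKFrame [CompleteSpace H] {Ω : Type*} [MeasurableSpace Ω]
    (μ : MeasureTheory.Measure Ω) (C K : EndStar A H) (F : Ω → H) : Prop where
  isGLPos : C.IsGLPos
  weaklyMeasurable : ∀ f : H, @Measurable Ω A _ (borel A) fun w => inner A (F w) f
  integrable : ∀ f : H,
    MeasureTheory.Integrable (fun w => inner A (F w) f * inner A f (C.1 (F w))) μ
  bounds : ∃ a b : ℝ, 0 < a ∧ 0 < b ∧ ∀ f : H,
    a • inner A (C.posSqrt.1 ((star K).1 f)) (C.posSqrt.1 ((star K).1 f)) ≤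
      ∫ w, inner A (F w) f * inner A f (C.1 (F w)) ∂μ ∧
    ∫ w, inner A (F w) f * inner A f (C.1 (F w)) ∂μ ≤ b • inner A f f

/-- An `A`-submodule of a Hilbert `A`-module, with the restricted inner product. -/
noncomputable instance Submodule.instCStarModule [IsScalarTower ℂ A H] (M : Submodule A H) :
    CStarModule A M where
  inner x y := inner A (x : H) (y : H)
  inner_add_right := CStarModule.inner_add_right
  inner_self_nonneg := CStarModule.inner_self_nonneg
  inner_self := CStarModule.inner_self.trans Submodule.coe_eq_zero
  inner_op_smul_right := CStarModule.inner_op_smul_right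
  inner_smul_right_complex := CStarModule.inner_smul_right_complex
  star_inner _ _ := CStarModule.star_inner _ _
  norm_eq_sqrt_norm_inner_self x := CStarModule.norm_eq_sqrt_norm_inner_self (x : H)

/-- The range `R(T)` of an adjointable operator, an `A`-submodule of `H`. -/
def EndStar.range (T : EndStar A H) : Submodule A H where
  carrier := Set.range T.1
  zero_mem' := ⟨0, map_zero _⟩
  add_mem' := by
    rintro _ _ ⟨x, rfl⟩ ⟨y, rfl⟩
    exact ⟨x + y, map_add _ _ _⟩
  smul_mem' := by
    rintro a _ ⟨x, rfl⟩
    refine ⟨a • x, eq_of_inner_eq A fun z => ?_⟩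
    rw [EndStar.star_spec A T, CStarModule.inner_op_smul_right, CStarModule.inner_op_smul_right,
      EndStar.star_spec A T]

end Frames

/-! ### Positivity and invertibility of adjointable operators -/

section HilbertModule

variable {A : Type*} [CStarAlgebra A] [PartialOrder A]
variable {H : Type*} [NormedAddCommGroup H] [NormedSpace ℂ H] [Module A H] [CStarModule A H]

namespace EndStar

/-! Since `⟨f, T F(w)⟩ = ⟨T⋆ f, F(w)⟩` and `C T = T C`, the frame integral of `T F` at `f` is that
of `F` at `T⋆ f`. The upper bound follows from `T T⋆ ≤ ‖T⋆‖²`. For the lower bound, let `C'`, `K'`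
be the restrictions to `R(T)` and `g = K'⋆ f`. Then `K⋆ T⋆ f = T⋆ g`, so `⟨C K⋆ T⋆ f, K⋆ T⋆ f⟩ = ⟨T
T⋆ C' g, g⟩`. Closedness of `R(T)` makes `T T⋆` positive and invertible there
(`isGLPos_mulStarRange`), hence `≥ ε`; as it commutes with `C'`, this gives `T T⋆ C' ≥ ε C'`
(`smul_inner_le_of_commute`). The same invertibility yields the orthogonal projection onto `R(T)`,
which supplies adjoints for the restrictions. -/

theorem inner_star_apply (T : EndStar A H) (x y : H) :
    inner A y ((star T).1 x) = inner A (T.1 y) x :=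
  (EndStar.star_spec A T).symm A x y

theorem inner_apply_of_isSelfAdjoint {S : EndStar A H} (hS : IsSelfAdjoint S) (x y : H) :
    inner A y (S.1 x) = inner A (S.1 y) x := by
  have h := EndStar.star_spec A S x y
  rwa [hS.star_eq] at h

variable [StarOrderedRing A]

/-- Polarization: `⟨S z, z⟩` is self-adjoint in `A` for `z = x + y` and `z = x + i y`. -/
theorem isSelfAdjoint_of_inner_nonneg {S : EndStar A H} (hS : ∀ x : H, 0 ≤ inner A x (S.1 x)) :
    IsSelfAdjoint S := by
  have hsymm (x : H) : inner A (S.1 x) x = inner A x (S.1 x) := by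
    rw [← CStarModule.star_inner, (IsSelfAdjoint.of_nonneg (hS x)).star_eq]
  refine EndStar.adj_eq A fun x y => ?_
  have h1 := hsymm (x + y)
  have h2 := hsymm (x + Complex.I • y)
  simp only [map_add, map_smul, CStarModule.inner_add_left, CStarModule.inner_add_right,
    CStarModule.inner_smul_left_complex, CStarModule.inner_smul_right_complex, hsymm x,
    hsymm y, RCLike.star_def, Complex.conj_I] at h1 h2
  have h3 : inner A (S.1 x) y + inner A (S.1 y) x
      = inner A x (S.1 y) + inner A y (S.1 x) := by
    have := sub_eq_zero.mpr h1
    rw [← sub_eq_zero, ← this]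
    abel
  have h4 : Complex.I • (inner A (S.1 x) y - inner A (S.1 y) x)
      = Complex.I • (inner A x (S.1 y) - inner A y (S.1 x) : A) := by
    have := sub_eq_zero.mpr h2
    rw [← sub_eq_zero, ← this]
    module
  have h5 := smul_right_injective A Complex.I_ne_zero h4
  have h6 : (2 : ℂ) • inner A (S.1 y) x = (2 : ℂ) • (inner A y (S.1 x) : A) := by
    rw [two_smul, two_smul]
    have e1 := sub_eq_zero.mpr h3
    have e2 := sub_eq_zero.mpr h5
    rw [← sub_eq_zero, ← sub_eq_zero.mpr (e1.trans e2.symm)]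
    abel
  exact (smul_right_injective A (two_ne_zero (α := ℂ)) h6).symm

variable [CompleteSpace H]

/-- If `0` were in the spectrum, a tent function `f` with `f 0 = 1`, supported in `|t| ≤ c / 2`,
would give `‖f(S)‖ ≥ 1` but `‖S f(S)‖ ≤ c / 2`, contradicting `‖S f(S)‖ ≥ c ‖f(S)‖`. -/
theorem isUnit_of_boundedBelow {S : EndStar A H} (hS : IsSelfAdjoint S) {c : ℝ} (hc : 0 < c)
    (h : ∀ x : H, c * ‖x‖ ≤ ‖S.1 x‖) : IsUnit S := by
  by_contra hu
  have h0 : (0 : ℝ) ∈ spectrum ℝ S := spectrum.zero_mem ℝ hu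
  let f : ℝ → ℝ := fun t => max 0 (1 - 2 / c * |t|)
  have hf : Continuous f := by fun_prop
  have h1 : (1 : ℝ) ≤ ‖cfc f S‖ := by
    have := norm_apply_le_norm_cfc f S h0 hf.continuousOn
    simpa [f] using this
  have h2 : ‖S * cfc f S‖ ≤ c / 2 := by
    have : S * cfc f S = cfc (fun t => t * f t) S := by
      rw [cfc_mul (fun t : ℝ => t) f S continuousOn_id hf.continuousOn, cfc_id' ℝ S]
    rw [this]
    refine norm_cfc_le (by positivity) fun t _ => ?_
    rw [norm_mul, Real.norm_eq_abs, Real.norm_eq_abs, abs_of_nonneg (show 0 ≤ f t from le_max_left _ _)]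
    have ht : 0 ≤ 2 / c * |t| := by positivity
    rcases le_total (2 / c * |t|) 1 with h | h
    · have h3 : |t| ≤ c / 2 := by
        rw [div_mul_eq_mul_div, div_le_one hc] at h
        linarith
      calc |t| * f t ≤ c / 2 * 1 := by
            refine mul_le_mul h3 (max_le zero_le_one ?_) (le_max_left _ _) (by positivity)
            linarith
        _ = c / 2 := mul_one _
    · have : f t = 0 := max_eq_left (by linarith)
      rw [this, mul_zero]
      positivity
  have h3 : ‖cfc f S‖ ≤ c⁻¹ * ‖S * cfc f S‖ := by
    refine ContinuousLinearMap.opNorm_le_bound _ (by positivity) fun x => ?_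
    have h4 := (h ((cfc f S).1 x)).trans ((S * cfc f S).1.le_opNorm x)
    rw [mul_assoc, ← div_eq_inv_mul, le_div_iff₀' hc]
    exact h4
  have h5 : c⁻¹ * ‖S * cfc f S‖ ≤ c⁻¹ * (c / 2) := by gcongr
  have h6 : c⁻¹ * (c / 2) = 1 / 2 := by field_simp
  linarith

/-- For `t < 0`, `⟨(S - t) x, x⟩ ≥ -t ⟨x, x⟩`, so by Cauchy–Schwarz `S - t` is bounded below by
`-t`, hence invertible. -/
theorem spectrum_nonneg_of_inner_nonneg {S : EndStar A H}
    (hS : ∀ x : H, 0 ≤ inner A x (S.1 x)) {t : ℝ} (ht : t ∈ spectrum ℝ S) : 0 ≤ t := by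
  by_contra! hneg
  refine ht ?_
  rw [spectrum.mem_resolventSet_iff, ← IsUnit.neg_iff, neg_sub]
  have hsa := isSelfAdjoint_of_inner_nonneg hS
  refine isUnit_of_boundedBelow (hsa.sub (IsSelfAdjoint.algebraMap _ (.all t)))
    (neg_pos.mpr hneg) fun x => ?_
  have hval : (S - algebraMap ℝ (EndStar A H) t).1 x = S.1 x + (-t) • x := by
    rw [neg_smul, ← sub_eq_add_neg, Algebra.algebraMap_eq_smul_one]
    rfl
  rw [hval]
  have h1 : (-t) • inner A x x ≤ inner A x (S.1 x + (-t) • x) := by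
    rw [CStarModule.inner_add_right, CStarModule.inner_smul_right_real]
    exact le_add_of_nonneg_left (hS x)
  have h2 := (CStarAlgebra.norm_le_norm_of_nonneg_of_le
    (smul_nonneg (neg_pos.mpr hneg).le CStarModule.inner_self_nonneg) h1).trans
      (CStarModule.norm_inner_le H)
  rw [norm_smul, Real.norm_of_nonneg (neg_pos.mpr hneg).le, ← CStarModule.norm_sq_eq A] at h2
  rcases (norm_nonneg x).eq_or_lt with h | h
  · rw [← h, mul_zero]
    exact norm_nonneg _
  · refine le_of_mul_le_mul_right ?_ h
    linarith

theorem isSelfAdjoint_posSqrt (S : EndStar A H) : IsSelfAdjoint S.posSqrt :=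
  cfc_predicate Real.sqrt S

theorem posSqrt_mul_self {S : EndStar A H} (hS : ∀ x : H, 0 ≤ inner A x (S.1 x)) :
    S.posSqrt * S.posSqrt = S := by
  have hsa := isSelfAdjoint_of_inner_nonneg hS
  rw [posSqrt, ← cfc_mul Real.sqrt Real.sqrt S (by fun_prop) (by fun_prop)]
  conv_rhs => rw [← cfc_id' ℝ S]
  exact cfc_congr fun t ht => Real.mul_self_sqrt (spectrum_nonneg_of_inner_nonneg hS ht)

theorem inner_posSqrt_apply {S : EndStar A H} (hS : ∀ x : H, 0 ≤ inner A x (S.1 x)) (x y : H) :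
    inner A (S.posSqrt.1 x) (S.posSqrt.1 y) = inner A x (S.1 y) := by
  rw [← inner_apply_of_isSelfAdjoint (isSelfAdjoint_posSqrt S)]
  conv_rhs => rw [← posSqrt_mul_self hS]
  rfl

/-- In the spectral order of the `C⋆`-algebra `End*_A(H)`, `‖T‖² - T⋆ T` is nonnegative, hence of
the form `R⋆ R`. -/
theorem inner_apply_self_le (T : EndStar A H) (x : H) :
    inner A (T.1 x) (T.1 x) ≤ ‖T‖ ^ 2 • inner A x x := by
  let _ := CStarAlgebra.spectralOrder (EndStar A H)
  have := CStarAlgebra.spectralOrderedRing (EndStar A H)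
  have h1 : 0 ≤ algebraMap ℝ (EndStar A H) ‖star T * T‖ - star T * T :=
    sub_nonneg.mpr (IsSelfAdjoint.le_algebraMap_norm_self (.star_mul_self T))
  obtain ⟨R, hR⟩ := CStarAlgebra.nonneg_iff_eq_star_mul_self.mp h1
  rw [CStarRing.norm_star_mul_self, ← sq, sub_eq_iff_eq_add, Algebra.algebraMap_eq_smul_one] at hR
  have h2 : ‖T‖ ^ 2 • inner A x x = inner A x ((star R * R + star T * T).1 x) := by
    rw [← hR, ← CStarModule.inner_smul_right_real]
    rfl
  have h3 : (star R * R + star T * T).1 x = (star R).1 (R.1 x) + (star T).1 (T.1 x) := rfl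
  rw [h2, h3, CStarModule.inner_add_right, inner_star_apply, inner_star_apply]
  exact le_add_of_nonneg_left CStarModule.inner_self_nonneg

/-- A positive invertible operator dominates a positive multiple of the identity. -/
theorem IsGLPos.exists_smul_inner_le {S : EndStar A H} (hS : S.IsGLPos) :
    ∃ ε : ℝ, 0 < ε ∧ ∀ x : H, ε • inner A x x ≤ inner A x (S.1 x) := by
  have hR : IsUnit S.posSqrt := by
    have h := hS.2
    rw [← posSqrt_mul_self hS.1] at h
    exact ((Commute.refl S.posSqrt).isUnit_mul_iff.mp h).1
  obtain ⟨u, hu⟩ := hR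
  let U : EndStar A H := ↑u⁻¹
  -- `U = S^{-1/2}` may vanish when `H` is trivial; the `+ 1` keeps the constant positive.
  have hb : 0 < ‖U‖ ^ 2 + 1 := by positivity
  refine ⟨(‖U‖ ^ 2 + 1)⁻¹, inv_pos.mpr hb, fun x => ?_⟩
  have hx : U.1 (S.posSqrt.1 x) = x := by
    have h : U * S.posSqrt = 1 := by rw [← hu]; exact u.inv_mul
    exact congrArg (fun V : EndStar A H => V.1 x) h
  have h1 := inner_apply_self_le U (S.posSqrt.1 x)
  rw [hx, inner_posSqrt_apply hS.1] at h1
  have h2 : inner A x x ≤ (‖U‖ ^ 2 + 1) • inner A x (S.1 x) := by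
    refine h1.trans ?_
    rw [add_smul, one_smul]
    exact le_add_of_nonneg_right (hS.1 x)
  calc _ ≤ (‖U‖ ^ 2 + 1)⁻¹ • (‖U‖ ^ 2 + 1) • inner A x (S.1 x) :=
        smul_le_smul_of_nonneg_left h2 (inv_pos.mpr hb).le
    _ = _ := inv_smul_smul₀ hb.ne' _

/-- If `S ≥ ε` and `C ≥ 0` commute, then `S C ≥ ε C`. -/
theorem smul_inner_le_of_commute {S C : EndStar A H} {ε : ℝ}
    (hS : ∀ x : H, ε • inner A x x ≤ inner A x (S.1 x))
    (hC : ∀ x : H, 0 ≤ inner A x (C.1 x)) (hCS : Commute C S) (x : H) :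
    ε • inner A x (C.1 x) ≤ inner A x (S.1 (C.1 x)) := by
  have hcomm : Commute C.posSqrt S := hCS.cfc_real Real.sqrt
  -- `S` commutes with `C^{1/2}`, so the bound on `S` can be applied at `C^{1/2} x`.
  have h : S * C = C.posSqrt * (S * C.posSqrt) := by
    rw [← mul_assoc, hcomm.eq, mul_assoc, posSqrt_mul_self hC]
  have h1 : S.1 (C.1 x) = C.posSqrt.1 (S.1 (C.posSqrt.1 x)) :=
    congrArg (fun V : EndStar A H => V.1 x) h
  rw [h1, inner_apply_of_isSelfAdjoint (isSelfAdjoint_posSqrt C), ← inner_posSqrt_apply hC]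
  exact hS _

end EndStar

end HilbertModule

/-! ### Operators on a complete range -/

section ClosedRange

variable {A : Type*} [CStarAlgebra A] [PartialOrder A] [StarOrderedRing A]
variable {H : Type*} [NormedAddCommGroup H] [NormedSpace ℂ H] [Module A H] [IsScalarTower ℂ A H]
variable [CStarModule A H]

/-- The restriction of a bounded operator to an invariant `A`-submodule. -/
def ContinuousLinearMap.restrictSubmodule (M : Submodule A H) (R : H →L[ℂ] H)
    (hR : ∀ x ∈ M, R x ∈ M) : M →L[ℂ] M where
  toFun x := ⟨R x, hR x x.2⟩
  map_add' x y := Subtype.ext (map_add R (x : H) y)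
  map_smul' c x := Subtype.ext (map_smul R c (x : H))
  cont := by fun_prop

namespace EndStar

/-- An adjointable operator, as a map onto its range. -/
def toRange (T : EndStar A H) : H →L[ℂ] T.range where
  toFun x := ⟨T.1 x, x, rfl⟩
  map_add' x y := Subtype.ext (map_add T.1 x y)
  map_smul' c x := Subtype.ext (map_smul T.1 c x)
  cont := by fun_prop

omit [StarOrderedRing A] [IsScalarTower ℂ A H] in
theorem apply_mem_range_of_commute {R T : EndStar A H} (h : Commute R T) :
    ∀ x ∈ T.range, R.1 x ∈ T.range := by
  rintro _ ⟨x, rfl⟩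
  exact ⟨R.1 x, (congrArg (fun V : EndStar A H => V.1 x) h.eq).symm⟩

/-- The operator `T T⋆`, restricted to the range of `T`. -/
noncomputable def mulStarRange (T : EndStar A H) : EndStar A T.range :=
  ⟨ContinuousLinearMap.restrictSubmodule T.range (T * star T).1 fun x _ => ⟨(star T).1 x, rfl⟩,
    ContinuousLinearMap.restrictSubmodule T.range (T * star T).1 fun x _ => ⟨(star T).1 x, rfl⟩,
    fun x y => inner_apply_of_isSelfAdjoint (.mul_star_self T) (x : H) (y : H)⟩

omit [StarOrderedRing A] in
theorem inner_mulStarRange_apply (T : EndStar A H) (x y : T.range) :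
    inner A x (T.mulStarRange.1 y) = inner A ((star T).1 (x : H)) ((star T).1 (y : H)) := by
  have h := inner_star_apply (star T) ((star T).1 (y : H)) (x : H)
  rwa [star_star] at h

omit [StarOrderedRing A] in
theorem inner_mulStarRange_self_nonneg (T : EndStar A H) (x : T.range) :
    0 ≤ inner A x (T.mulStarRange.1 x) := by
  rw [inner_mulStarRange_apply]
  exact CStarModule.inner_self_nonneg

/-- By the open mapping theorem `y = T x` with `‖x‖ ≤ c ‖y‖`; then `‖y‖² = ‖⟨x, T⋆ y⟩‖ ≤ c ‖y‖ ‖T⋆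
y‖`. -/
theorem exists_norm_le_norm_star_apply [CompleteSpace H] (T : EndStar A H)
    [CompleteSpace T.range] :
    ∃ c : ℝ, 0 < c ∧ ∀ y : T.range, ‖y‖ ≤ c * ‖(star T).1 (y : H)‖ := by
  have hsurj : Function.Surjective T.toRange := by
    rintro ⟨_, x, rfl⟩
    exact ⟨x, rfl⟩
  obtain ⟨c, hc, h⟩ := T.toRange.exists_preimage_norm_le hsurj
  refine ⟨c, hc, fun y => ?_⟩
  obtain ⟨x, hx, hxy⟩ := h y
  rcases (norm_nonneg y).eq_or_lt with h0 | h0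
  · rw [← h0]
    positivity
  · refine le_of_mul_le_mul_right ?_ h0
    have h1 : inner A y y = inner A x ((star T).1 (y : H)) := by
      rw [inner_star_apply]
      exact congrArg (fun z : T.range => inner A z y) hx.symm
    calc ‖y‖ * ‖y‖ = ‖(inner A y y : A)‖ := by rw [← sq, CStarModule.norm_sq_eq A]
      _ ≤ ‖x‖ * ‖(star T).1 (y : H)‖ := h1 ▸ CStarModule.norm_inner_le H
      _ ≤ c * ‖y‖ * ‖(star T).1 (y : H)‖ := by gcongr
      _ = c * ‖(star T).1 (y : H)‖ * ‖y‖ := by ring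

/-- If the range of `T` is complete, then `T T⋆` is positive and invertible on it. -/
theorem isGLPos_mulStarRange [CompleteSpace H] (T : EndStar A H) [CompleteSpace T.range] :
    T.mulStarRange.IsGLPos := by
  refine ⟨T.inner_mulStarRange_self_nonneg, ?_⟩
  obtain ⟨c, hc, h⟩ := T.exists_norm_le_norm_star_apply
  refine isUnit_of_boundedBelow (isSelfAdjoint_of_inner_nonneg T.inner_mulStarRange_self_nonneg)
    (c := (c ^ 2)⁻¹) (by positivity) fun y => ?_
  rw [inv_mul_le_iff₀ (by positivity)]
  rcases (norm_nonneg y).eq_or_lt with h0 | h0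
  · rw [← h0]
    positivity
  · refine le_of_mul_le_mul_right ?_ h0
    have h1 : ‖(star T).1 (y : H)‖ ^ 2 ≤ ‖y‖ * ‖T.mulStarRange.1 y‖ := by
      rw [CStarModule.norm_sq_eq A, ← inner_mulStarRange_apply]
      exact CStarModule.norm_inner_le _
    calc ‖y‖ * ‖y‖ ≤ (c * ‖(star T).1 (y : H)‖) * (c * ‖(star T).1 (y : H)‖) :=
          mul_self_le_mul_self h0.le (h y)
      _ = c ^ 2 * ‖(star T).1 (y : H)‖ ^ 2 := by ring
      _ ≤ c ^ 2 * (‖y‖ * ‖T.mulStarRange.1 y‖) := by gcongr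
      _ = c ^ 2 * ‖T.mulStarRange.1 y‖ * ‖y‖ := by ring

/-- A complete range is orthogonally complemented: the orthogonal projection onto it exists. -/
theorem exists_projection_range [CompleteSpace H] (T : EndStar A H) [CompleteSpace T.range] :
    ∃ P : H →L[ℂ] T.range, ∀ (x : H) (y : T.range), inner A y (P x) = inner A (y : H) x := by
  obtain ⟨u, hu⟩ := T.isGLPos_mulStarRange.2
  -- The projection is `(T T⋆)⁻¹ T T⋆`, with the inverse taken on `R(T)`.
  refine ⟨(↑u⁻¹ : EndStar A T.range).1 ∘L T.toRange ∘L (star T).1, fun x y => ?_⟩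
  have hsa := isSelfAdjoint_of_inner_nonneg T.inner_mulStarRange_self_nonneg
  let z : T.range := (↑u⁻¹ : EndStar A T.range).1 y
  have hz : T.mulStarRange.1 z = y := by
    rw [← hu]
    exact congrArg (fun V : EndStar A T.range => V.1 y) u.mul_inv
  have hsa' : IsSelfAdjoint (↑u⁻¹ : EndStar A T.range) := by
    rw [← hu] at hsa
    have h : star u = u := Units.ext hsa
    exact congrArg Units.val (by rw [star_inv, h] : star u⁻¹ = u⁻¹)
  rw [ContinuousLinearMap.comp_apply, inner_apply_of_isSelfAdjoint hsa']
  change inner A (z : H) (T.1 ((star T).1 x)) = inner A (y : H) x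
  have h := inner_apply_of_isSelfAdjoint (.mul_star_self T) x (z : H)
  refine h.trans ?_
  exact congrArg (fun v : T.range => inner A (v : H) x) hz

/-- An adjointable operator commuting with `T` restricts to an adjointable operator on the range
of `T`, if that range is complete. -/
theorem exists_restrict_range [CompleteSpace H] {R T : EndStar A H} [CompleteSpace T.range]
    (h : Commute R T) : ∃ R' : EndStar A T.range, ∀ x : T.range, (R'.1 x : H) = R.1 (x : H) := by
  obtain ⟨P, hP⟩ := T.exists_projection_range
  -- `R⋆` need not preserve `R(T)`, so the adjoint of the restriction is the compression `P R⋆`.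
  refine ⟨⟨ContinuousLinearMap.restrictSubmodule T.range R.1 (apply_mem_range_of_commute h),
    { toFun := fun x => P ((star R).1 (x : H))
      map_add' := fun x y => by simp
      map_smul' := fun c x => by simp
      cont := by fun_prop }, fun x y => ?_⟩, fun x => rfl⟩
  have h1 := hP ((star R).1 (y : H)) x
  rw [inner_star_apply] at h1
  rw [← CStarModule.star_inner x]
  refine Eq.trans ?_ (congrArg star h1).symm
  exact (CStarModule.star_inner _ _).symm

omit [StarOrderedRing A] in
-- `R'⋆ x` and `R⋆ x` may differ, but only by a vector orthogonal to `R(T)`, which `T⋆` kills.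
theorem star_apply_star_restrict {R T : EndStar A H} {R' : EndStar A T.range}
    (hR' : ∀ x : T.range, (R'.1 x : H) = R.1 (x : H)) (x : T.range) :
    (star T).1 ((star R').1 x : H) = (star T).1 ((star R).1 (x : H)) := by
  refine eq_of_inner_eq A fun z => ?_
  rw [inner_star_apply, inner_star_apply, inner_star_apply]
  have h := inner_star_apply R' x (T.toRange z)
  refine h.trans ?_
  exact congrArg (fun v : H => inner A v (x : H)) (hR' (T.toRange z))

theorem isGLPos_restrict_range [CompleteSpace H] {C T : EndStar A H} [CompleteSpace T.range]
    (hC : C.IsGLPos) (h : Commute C T) {C' : EndStar A T.range}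
    (hC' : ∀ x : T.range, (C'.1 x : H) = C.1 (x : H)) : C'.IsGLPos := by
  refine ⟨fun x => ?_, ?_⟩
  · have := hC.1 x
    rw [← hC'] at this
    exact this
  · obtain ⟨u, rfl⟩ := hC.2
    -- `C⁻¹` also commutes with `T`, so it restricts to an inverse of `C'`.
    obtain ⟨D', hD'⟩ := exists_restrict_range (h.units_inv_left)
    refine isUnit_iff_exists.mpr ⟨D', ?_, ?_⟩
    · ext x
      refine (hC' _).trans ?_
      refine (congrArg _ (hD' x)).trans ?_
      exact congrArg (fun V : EndStar A H => V.1 (x : H)) u.mul_inv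
    · ext x
      refine (hD' _).trans ?_
      refine (congrArg _ (hC' x)).trans ?_
      exact congrArg (fun V : EndStar A H => V.1 (x : H)) u.inv_mul

end EndStar

end ClosedRange

/-! ### The lower frame bound and the theorem -/

section Frames

variable {A : Type*} [CStarAlgebra A] [PartialOrder A] [StarOrderedRing A]
variable {H : Type*} [NormedAddCommGroup H] [NormedSpace ℂ H] [Module A H] [IsScalarTower ℂ A H]
variable [CStarModule A H]

namespace EndStar

theorem exists_smul_inner_posSqrt_range_le [CompleteSpace H] {C K T : EndStar A H}
    [CompleteSpace T.range] (hC : C.IsGLPos) (hCT : Commute C T) (hKT : Commute K T)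
    {C' K' : EndStar A T.range} (hC' : ∀ x : T.range, (C'.1 x : H) = C.1 (x : H))
    (hK' : ∀ x : T.range, (K'.1 x : H) = K.1 (x : H)) :
    ∃ ε : ℝ, 0 < ε ∧ ∀ f : T.range,
      ε • inner A (C'.posSqrt.1 ((star K').1 f)) (C'.posSqrt.1 ((star K').1 f)) ≤
        inner A (C.posSqrt.1 ((star K).1 ((star T).1 (f : H))))
          (C.posSqrt.1 ((star K).1 ((star T).1 (f : H)))) := by
  have hCpos' := isGLPos_restrict_range hC hCT hC'
  obtain ⟨ε, hε, hS⟩ := T.isGLPos_mulStarRange.exists_smul_inner_le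
  -- Self-adjointness of `C` turns commutation with `T` into commutation with `T⋆`, hence with `T
  -- T⋆`.
  have hCT' : C * star T = star T * C := by
    have h := congrArg star hCT.eq
    rw [star_mul, star_mul, (isSelfAdjoint_of_inner_nonneg hC.1).star_eq] at h
    exact h.symm
  have hKT' : star K * star T = star T * star K := by
    rw [← star_mul, ← star_mul, hKT.eq]
  have hcomm : Commute C' T.mulStarRange := by
    have h : C * (T * star T) = (T * star T) * C := by
      rw [← mul_assoc, hCT.eq, mul_assoc, hCT', mul_assoc]
    refine Subtype.ext (ContinuousLinearMap.ext fun x => Subtype.ext ?_)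
    refine (hC' _).trans ((congrArg (fun V : EndStar A H => V.1 (x : H)) h).trans ?_)
    exact congrArg (T * star T).1 (hC' x).symm
  refine ⟨ε, hε, fun f => ?_⟩
  rw [inner_posSqrt_apply hCpos'.1, inner_posSqrt_apply hC.1]
  have h1 : (star K).1 ((star T).1 (f : H)) = (star T).1 ((star K').1 f : H) := by
    rw [star_apply_star_restrict hK']
    exact congrArg (fun V : EndStar A H => V.1 (f : H)) hKT'
  have h2 (g : T.range) : C.1 ((star T).1 (g : H)) = (star T).1 (C'.1 g : H) := by
    rw [hC']
    exact congrArg (fun V : EndStar A H => V.1 (g : H)) hCT'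
  rw [h1, h2, ← inner_mulStarRange_apply]
  exact smul_inner_le_of_commute hS hCpos'.1 hcomm _

end EndStar

end Frames

theorem mainTheorem5
    {A : Type*} [CStarAlgebra A] [PartialOrder A] [StarOrderedRing A]
    {H : Type*} [NormedAddCommGroup H] [NormedSpace ℂ H] [Module A H] [IsScalarTower ℂ A H]
    [CStarModule A H] [CompleteSpace H]
    {Ω : Type*} [MeasurableSpace Ω] (μ : MeasureTheory.Measure Ω)
    (C K T : EndStar A H) (F : Ω → H)
    (hF : IsContinuousControlledKFrame μ C K F)
    (hT : IsClosed (Set.range T.1))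
    (hKT : IsClosed (Set.range (star K * star T).1))
    (hCK : Commute C K) (hCT : Commute C T) (hKTcomm : Commute K T) :
    -- `R(T)` is a Hilbert module, to which `C` and `K` restrict as adjointable operators
    ∃ (_ : CompleteSpace T.range) (C' K' : EndStar A T.range),
      (∀ x : T.range, (C'.1 x : H) = C.1 (x : H)) ∧
      (∀ x : T.range, (K'.1 x : H) = K.1 (x : H)) ∧
      IsContinuousControlledKFrame μ C' K' (fun w => (⟨T.1 (F w), F w, rfl⟩ : T.range)) := by
  have hM : CompleteSpace T.range := hT.completeSpace_coe
  obtain ⟨C', hC'⟩ := EndStar.exists_restrict_range hCT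
  obtain ⟨K', hK'⟩ := EndStar.exists_restrict_range hKTcomm
  refine ⟨hM, C', K', hC', hK', ?_⟩
  have hinner (w : Ω) (f : T.range) :
      inner A (⟨T.1 (F w), F w, rfl⟩ : T.range) f = inner A (F w) ((star T).1 (f : H)) :=
    (EndStar.inner_star_apply T (f : H) (F w)).symm
  have hinner' (w : Ω) (f : T.range) :
      inner A f (C'.1 (⟨T.1 (F w), F w, rfl⟩ : T.range)) =
        inner A ((star T).1 (f : H)) (C.1 (F w)) := by
    rw [← EndStar.star_spec A T]
    refine congrArg (fun v : H => inner A (f : H) v) ((hC' _).trans ?_)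
    exact congrArg (fun V : EndStar A H => V.1 (F w)) hCT.eq
  obtain ⟨a, b, ha, hb, hab⟩ := hF.bounds
  obtain ⟨ε, hε, hlow⟩ :=
    EndStar.exists_smul_inner_posSqrt_range_le hF.isGLPos hCT hKTcomm hC' hK'
  refine ⟨EndStar.isGLPos_restrict_range hF.isGLPos hCT hC', fun f => ?_, fun f => ?_,
    -- The `+ 1` keeps the upper constant positive even when `T = 0`.
    a * ε, b * (‖star T‖ ^ 2 + 1), by positivity, by positivity, fun f => ?_⟩
  · simp only [hinner]
    exact hF.weaklyMeasurable _
  · simp only [hinner, hinner']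
    exact hF.integrable _
  · simp only [hinner, hinner']
    obtain ⟨h1, h2⟩ := hab ((star T).1 (f : H))
    refine ⟨le_trans ?_ h1, h2.trans ?_⟩
    · rw [mul_smul]
      exact smul_le_smul_of_nonneg_left (hlow f) ha.le
    · rw [mul_smul]
      refine smul_le_smul_of_nonneg_left ?_ hb.le
      refine ((star T).inner_apply_self_le (f : H)).trans ?_
      rw [add_smul, one_smul]
      exact le_add_of_nonneg_right CStarModule.inner_self_nonneg
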